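/- Let $\gamma>0$. For $E\in[-1,1]$ consider on the strip $(-\frac{\pi}{2},\frac{\pi}{2})\times\mathbb{R}$ (the universal cover of a cylinder, $2\pi$-periodic in $\Theta$) the dynamical system $$\dot z=\cos^2 z,\qquad \dot\Theta=2\cos\Theta-\gamma e^{-|\tan z|}-2E .$$ Let $S_E^-=(-\frac{\pi}{2},\arccos E)$ and $S_E^+=(\frac{\pi}{2},-\arccos E)$. For a trajectory along which $\Theta$ has limits $\Theta(\pm\infty)$ as time tends to $\pm\infty$, the winding number is $$w=\left\lfloor\frac{\Theta(-\infty)-\Theta(\infty)}{2\pi}\right\rfloor .$$ For $|E|<1$, a saddles connector at energy $E$ is a trajectory in the open strip whose $\alpha$-limit set is $\{S_E^-\}$ and whose $\omega$-limit set is $\{S_E^+-(0,2\pi k)\}$ for some $k\in\mathbb{Z}$. Theorem. Let $N\in\mathbb{Z}$ and $-1\le E'<E''\le 1$. Write $w_E\le n$ (respectively $w_E\ge n$) if every trajectory in the open strip at energy $E$ with $\alpha$-limit set $\{S_E^-\}$ has a winding number that is $\le n$ (respectively $\ge n$). If $$w_{E'}\le N\quad\text{and}\quad w_{E''}\ge N+1,$$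 then there is a saddles connector with winding number $N$ at some energy $E\in(E',E'')$, unless there already is one at the energy $E'$ itself. -/

import Mathlib

open Real Set Filter Topology

namespace DiracCylinder

/-- The vector field `(z, Θ) ↦ (cos² z, 2 cos Θ - γ exp (-|tan z|) - 2 E)`, used on the open strip
`-π/2 < z < π/2` of the universal cover of the cylinder. -/
noncomputable def field (γ E : ℝ) (p : ℝ × ℝ) : ℝ × ℝ :=
  (cos p.1 ^ 2, 2 * cos p.2 - γ * exp (-|tan p.1|) - 2 * E)

/-- A trajectory, defined for all times, in the open strip `-π/2 < z < π/2`. Since `z = arctan s`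
along it, these are the solutions of `Θ' = 2 cos Θ - γ exp (-|s|) - 2 E`; the orbits contained
in the two boundary lines `z = ±π/2`, in particular the equilibria, are left out. -/
def IsTrajectory (γ E : ℝ) (y : ℝ → ℝ × ℝ) : Prop :=
  ∀ τ : ℝ, (y τ).1 ∈ Ioo (-(π / 2)) (π / 2) ∧ HasDerivAt y (field γ E (y τ)) τ

/-- The `α`-limit set of a curve. -/
def alphaLimitSet (y : ℝ → ℝ × ℝ) : Set (ℝ × ℝ) :=
  {p | ∃ t : ℕ → ℝ, Tendsto t atTop atBot ∧ Tendsto (fun n => y (t n)) atTop (𝓝 p)}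

/-- The `ω`-limit set of a curve. -/
def omegaLimitSet (y : ℝ → ℝ × ℝ) : Set (ℝ × ℝ) :=
  {p | ∃ t : ℕ → ℝ, Tendsto t atTop atTop ∧ Tendsto (fun n => y (t n)) atTop (𝓝 p)}

/-- The equilibrium point `S_E^-` in the fundamental domain. -/
noncomputable def saddleLeft (E : ℝ) : ℝ × ℝ := (-(π / 2), arccos E)

/-- The copy of the equilibrium point `S_E^+ = (π/2, -arccos E)` shifted down by `2 π k`. -/
noncomputable def saddleRight (E : ℝ) (k : ℤ) : ℝ × ℝ := (π / 2, -arccos E - 2 * π * k)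

/-- `y` is a trajectory at energy `E` whose `α`-limit is `S_E^-`. -/
def LeavesSaddle (γ E : ℝ) (y : ℝ → ℝ × ℝ) : Prop :=
  IsTrajectory γ E y ∧ alphaLimitSet y = {saddleLeft E}

/-- `Θ` has limits at `±∞` along `y`, and `w = ⌊(Θ(-∞) - Θ(∞)) / (2 π)⌋`. -/
def HasWindingNumber (y : ℝ → ℝ × ℝ) (w : ℤ) : Prop :=
  ∃ a b : ℝ, Tendsto (fun τ => (y τ).2) atBot (𝓝 a) ∧ Tendsto (fun τ => (y τ).2) atTop (𝓝 b) ∧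
    w = ⌊(a - b) / (2 * π)⌋

/-- `y` is a saddles connector at energy `E`: a trajectory from `S_E^-` to a copy of `S_E^+`.
The points `S_E^±` are saddle-nodes only for `|E| < 1`, so that this is part of the definition. -/
def IsSaddlesConnector (γ E : ℝ) (y : ℝ → ℝ × ℝ) : Prop :=
  -1 < E ∧ E < 1 ∧ LeavesSaddle γ E y ∧ ∃ k : ℤ, omegaLimitSet y = {saddleRight E k}

end DiracCylinder

namespace DiracCylinder

/-! With `s = tan z` the system becomes one scalar equation, so solutions are ordered and compared
by their values at `s = 0`. Let `u(E)` be the value at 0 of the uppermost solution staying below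
`arccos E`; this solution leaves the left saddle. The symmetry `(s, Θ) ↦ (-s, -Θ - 2πN)` turns it
into a solution entering the `N`-th copy of the right saddle, and for `|E| < 1` the two coincide,
giving a connector of winding number `N`, when `u(E) = -πN`.

Comparing the two at infinity, the winding hypotheses give `u(E₁) ≥ -πN` and `u(E₂) < -πN`
(`le_unstableValue_of_winding`, `unstableValue_lt_of_winding`). Equality at `E₁` is the exceptional
case. Otherwise `exists_unstableValue_eq` supplies an intermediate energy. Full continuity of `u` is
not needed: `{E | c ≤ u(E)}` is closed, and `c < u(E)` persists weakly for slightly larger energies.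
The latter rests on a barrier `1/(2s)` valid for all `E ≤ 1` at once. -/

/-- The right-hand side of the `Θ`-equation after the substitution `z = arctan s`. -/
noncomputable def angleField (γ E s θ : ℝ) : ℝ := 2 * cos θ - γ * exp (-|s|) - 2 * E

/-- Global solutions of the `Θ`-equation in the variable `s = tan z`. -/
def IsSolution (γ E : ℝ) (θ : ℝ → ℝ) : Prop :=
  ∀ s, HasDerivAt θ (angleField γ E s (θ s)) s

/-! ### Global existence for the scalar equation -/

theorem lipschitzWith_angleField (γ E s : ℝ) : LipschitzWith 2 (angleField γ E s) := by
  refine LipschitzWith.of_dist_le_mul fun x y => ?_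
  have h := abs_cos_sub_cos_le x y
  rw [Real.dist_eq, Real.dist_eq]
  have : angleField γ E s x - angleField γ E s y = 2 * (cos x - cos y) := by
    unfold angleField; ring
  rw [this, abs_mul]
  simpa using h

theorem continuous_angleField_time (γ E x : ℝ) : Continuous fun s => angleField γ E s x := by
  unfold angleField; fun_prop

theorem abs_angleField_le (γ E s x : ℝ) : |angleField γ E s x| ≤ 2 + |γ| + 2 * |E| := by
  have h1 : |2 * cos x| ≤ 2 := by
    rw [abs_mul]; norm_num; exact abs_cos_le_one x
  have h2 : |γ * exp (-|s|)| ≤ |γ| := by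
    rw [abs_mul, abs_of_pos (exp_pos _)]
    exact mul_le_of_le_one_right (abs_nonneg _) (exp_le_one_iff.2 (by simp))
  have h3 : |2 * E| = 2 * |E| := by rw [abs_mul]; norm_num
  unfold angleField
  calc _ ≤ |2 * cos x - γ * exp (-|s|)| + |2 * E| := abs_sub _ _
    _ ≤ |2 * cos x| + |γ * exp (-|s|)| + |2 * E| := by gcongr; exact abs_sub _ _
    _ ≤ _ := by rw [h3]; gcongr

theorem exists_solution_Ioo (γ E t₀ x₀ T : ℝ) (hT : 0 < T) :
    ∃ α : ℝ → ℝ, α t₀ = x₀ ∧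
      ∀ t ∈ Ioo (t₀ - T) (t₀ + T), HasDerivAt α (angleField γ E t (α t)) t := by
  set M : NNReal := ⟨2 + |γ| + 2 * |E|, by positivity⟩ with hM
  have hmem : t₀ ∈ Icc (t₀ - T) (t₀ + T) := ⟨by linarith, by linarith⟩
  have hPL : IsPicardLindelof (angleField γ E) (⟨t₀, hmem⟩ : Icc (t₀ - T) (t₀ + T)) x₀
      (M * ⟨T, hT.le⟩) 0 M 2 :=
    { lipschitzOnWith := fun t _ => (lipschitzWith_angleField γ E t).lipschitzOnWith
      continuousOn := fun x _ => (continuous_angleField_time γ E x).continuousOn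
      norm_le := fun t _ x _ => abs_angleField_le γ E t x
      mul_max_le := by
        simp only [add_sub_cancel_left, sub_sub_cancel, max_self, NNReal.coe_zero, sub_zero]
        exact le_of_eq rfl }
  obtain ⟨α, h0, hα⟩ := hPL.exists_eq_forall_mem_Icc_hasDerivWithinAt₀
  exact ⟨α, h0, fun t ht => (hα t (Ioo_subset_Icc_self ht)).hasDerivAt (Icc_mem_nhds ht.1 ht.2)⟩

theorem exists_isSolution (γ E t₀ x₀ : ℝ) : ∃ θ, IsSolution γ E θ ∧ θ t₀ = x₀ := by
  have H : ∀ T : ℝ, ∃ α : ℝ → ℝ, 0 < T → α t₀ = x₀ ∧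
      ∀ t ∈ Ioo (t₀ - T) (t₀ + T), HasDerivAt α (angleField γ E t (α t)) t := fun T => by
    by_cases hT : 0 < T
    · obtain ⟨α, h⟩ := exists_solution_Ioo γ E t₀ x₀ T hT
      exact ⟨α, fun _ => h⟩
    · exact ⟨0, fun h => absurd h hT⟩
  choose α hα using H
  have huniq : ∀ T T' : ℝ, 0 < T → T ≤ T' → EqOn (α T) (α T') (Ioo (t₀ - T) (t₀ + T)) := by
    intro T T' hT hTT'
    refine ODE_solution_unique_of_mem_Ioo (v := angleField γ E) (K := 2) (s := fun _ => univ)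
      (fun t _ => (lipschitzWith_angleField γ E t).lipschitzOnWith)
      (t₀ := t₀) ⟨by linarith, by linarith⟩
      (fun t ht => ⟨(hα T hT).2 t ht, trivial⟩) (fun t ht => ⟨(hα T' (by linarith)).2 t
        ⟨by linarith [ht.1], by linarith [ht.2]⟩, trivial⟩) ?_
    rw [(hα T hT).1, (hα T' (by linarith)).1]
  -- The radius varies with `s`; near a given `s` uniqueness replaces the glued function by the
  -- single local solution of radius `|s - t₀| + 2`.
  refine ⟨fun s => α (|s - t₀| + 1) s, fun s => ?_, ?_⟩
  · have hpos := abs_nonneg (s - t₀)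
    have hs := abs_le.1 (le_refl |s - t₀|)
    have hmem : s ∈ Ioo (t₀ - (|s - t₀| + 1)) (t₀ + (|s - t₀| + 1)) :=
      ⟨by linarith, by linarith⟩
    have heq : (fun r => α (|r - t₀| + 1) r) =ᶠ[𝓝 s] α (|s - t₀| + 2) := by
      have : ∀ᶠ r in 𝓝 s, |r - t₀| < |s - t₀| + 1 :=
        (by fun_prop : Continuous fun r : ℝ => |r - t₀|).continuousAt.eventually_lt
          continuousAt_const (by linarith)
      filter_upwards [this] with r hr
      have hr' := abs_le.1 (le_refl |r - t₀|)
      exact huniq _ _ (by positivity) (by linarith) ⟨by linarith, by linarith⟩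
    have hd := (hα (|s - t₀| + 2) (by positivity)).2 s ⟨by linarith, by linarith⟩
    have := hd.congr_of_eventuallyEq heq
    rwa [← heq.eq_of_nhds] at this
  · exact (hα _ (by positivity)).1

/-! ### Order, symmetry, dependence on data and limits of solutions -/

namespace IsSolution

variable {γ E : ℝ} {θ φ : ℝ → ℝ}

theorem continuous (h : IsSolution γ E θ) : Continuous θ :=
  continuous_iff_continuousAt.2 fun s => (h s).continuousAt

theorem eq_of_eq (hθ : IsSolution γ E θ) (hφ : IsSolution γ E φ) {t : ℝ} (h : θ t = φ t) :
    θ = φ :=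
  ODE_solution_unique_univ (v := angleField γ E) (K := 2) (s := fun _ => univ)
    (fun t => (lipschitzWith_angleField γ E t).lipschitzOnWith)
    (fun t => ⟨hθ t, trivial⟩) (fun t => ⟨hφ t, trivial⟩) h

theorem lt_of_lt (hθ : IsSolution γ E θ) (hφ : IsSolution γ E φ) {t : ℝ} (h : θ t < φ t)
    (s : ℝ) : θ s < φ s := by
  by_contra! hs
  obtain ⟨r, hr⟩ : (0 : ℝ) ∈ range fun s => φ s - θ s :=
    mem_range_of_exists_le_of_exists_ge (hφ.continuous.sub hθ.continuous)
      ⟨s, by linarith⟩ ⟨t, by linarith⟩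
  have := hθ.eq_of_eq hφ (t := r) (by simpa [sub_eq_zero, eq_comm] using hr)
  simp [this] at h

theorem le_of_le (hθ : IsSolution γ E θ) (hφ : IsSolution γ E φ) {t : ℝ} (h : θ t ≤ φ t)
    (s : ℝ) : θ s ≤ φ s := by
  rcases h.eq_or_lt with h | h
  · rw [hθ.eq_of_eq hφ h]
  · exact (hθ.lt_of_lt hφ h s).le

/-- The equation is invariant under `(s, Θ) ↦ (-s, -Θ)` and under `Θ ↦ Θ - 2 π k`. -/
theorem reflect (h : IsSolution γ E θ) (k : ℤ) :
    IsSolution γ E fun s => -θ (-s) - 2 * π * k := by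
  intro s
  have h1 := (((h (-s)).comp s (hasDerivAt_neg s)).neg).sub_const (2 * π * k)
  convert! h1 using 1
  simp only [angleField]
  rw [show -θ (-s) - 2 * π * k = -(θ (-s) + k * (2 * π)) by ring, cos_neg,
    cos_add_int_mul_two_pi, abs_neg]
  ring

theorem abs_sub_le_of_nonneg {E' : ℝ} (hθ : IsSolution γ E θ) (hφ : IsSolution γ E' φ) {s : ℝ}
    (hs : 0 ≤ s) : |θ s - φ s| ≤ gronwallBound |θ 0 - φ 0| 2 (2 * |E - E'|) s := by
  have := dist_le_of_approx_trajectories_ODE (v := angleField γ E) (K := 2) (f := θ) (g := φ)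
    (a := 0) (b := s) (εf := 0) (εg := 2 * |E - E'|) (δ := |θ 0 - φ 0|)
    (fun t => lipschitzWith_angleField γ E t) hθ.continuous.continuousOn
    (fun t _ => (hθ t).hasDerivWithinAt) (fun t _ => by simp) hφ.continuous.continuousOn
    (fun t _ => (hφ t).hasDerivWithinAt) (fun t _ => ?_) (by rw [Real.dist_eq]) s ⟨hs, le_rfl⟩
  · simpa [Real.dist_eq] using this
  · rw [Real.dist_eq]
    have : angleField γ E' t (φ t) - angleField γ E t (φ t) = 2 * (E - E') := by
      unfold angleField; ring
    rw [this, abs_mul]; norm_num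

theorem abs_sub_le {E' : ℝ} (hθ : IsSolution γ E θ) (hφ : IsSolution γ E' φ) (s : ℝ) :
    |θ s - φ s| ≤ gronwallBound |θ 0 - φ 0| 2 (2 * |E - E'|) |s| := by
  rcases le_total 0 s with hs | hs
  · rw [abs_of_nonneg hs]; exact hθ.abs_sub_le_of_nonneg hφ hs
  · rw [abs_of_nonpos hs]
    have := (hθ.reflect 0).abs_sub_le_of_nonneg (hφ.reflect 0) (neg_nonneg.2 hs)
    simpa [abs_sub_comm, neg_add_eq_sub, sub_neg_eq_add] using this

/-- A strict subsolution bounds a solution from above in backward time. -/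
theorem le_of_subsolution {B B' : ℝ → ℝ} {S s₁ s : ℝ} (hθ : IsSolution γ E θ)
    (hB : ∀ r ≤ S, HasDerivAt B (B' r) r) (hlt : ∀ r ≤ S, B' r < angleField γ E r (B r))
    (hs₁ : s₁ ≤ S) (h₁ : θ s₁ ≤ B s₁) (hs : s ≤ s₁) : θ s ≤ B s := by
  have hd : ∀ t, HasDerivAt (fun t => θ (-t)) (-angleField γ E (-t) (θ (-t))) t := fun t => by
    simpa [Function.comp_def] using (hθ (-t)).comp t (hasDerivAt_neg t)
  have hdB : ∀ t, -S ≤ t → HasDerivAt (fun t => B (-t)) (-B' (-t)) t := fun t ht => by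
    simpa [Function.comp_def] using (hB (-t) (by linarith)).comp t (hasDerivAt_neg t)
  have := image_le_of_deriv_right_lt_deriv_boundary' (a := -s₁) (b := -s)
    (f := fun t => θ (-t)) (B := fun t => B (-t))
    (fun t _ => (hd t).continuousAt.continuousWithinAt) (fun t _ => (hd t).hasDerivWithinAt)
    (by simpa using h₁)
    (fun t ht => (hdB t (by linarith [ht.1])).continuousAt.continuousWithinAt)
    (fun t ht => (hdB t (by linarith [ht.1])).hasDerivWithinAt)
    (fun t ht heq => by
      have h := hlt (-t) (by linarith [ht.1])
      rw [heq]; linarith)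
    (show -s ∈ Icc (-s₁) (-s) from ⟨by linarith, le_rfl⟩)
  simpa using this

/-- On the level `arccos E` the field equals `-γ exp (-|t|) < 0`, so the level is crossed only
downwards. -/
theorem le_arccos_of_le (hγ : 0 < γ) (hE : -1 ≤ E) (hE' : E ≤ 1) {s₁ s : ℝ}
    (hθ : IsSolution γ E θ) (h₁ : θ s₁ ≤ arccos E) (hs : s₁ ≤ s) : θ s ≤ arccos E := by
  refine image_le_of_deriv_right_lt_deriv_boundary (a := s₁) (b := s) (B := fun _ => arccos E)
    (B' := fun _ => 0) hθ.continuous.continuousOn (fun t _ => (hθ t).hasDerivWithinAt) h₁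
    (fun t => hasDerivAt_const _ _) (fun t _ heq => ?_) ⟨hs, le_rfl⟩
  rw [heq, angleField, cos_arccos hE hE']
  have : 0 < γ * exp (-|t|) := by positivity
  linarith

/-- By the mean value theorem, increments over unit intervals are values of the field; the
increments tend to 0, the values to `2 cos b - 2 E`. -/
theorem cos_eq_of_tendsto_atTop (hθ : IsSolution γ E θ) {b : ℝ} (hb : Tendsto θ atTop (𝓝 b)) :
    cos b = E := by
  have hexp : Tendsto (fun s : ℝ => exp (-|s|)) atTop (𝓝 0) :=
    tendsto_exp_neg_atTop_nhds_zero.comp tendsto_abs_atTop_atTop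
  have hF : Tendsto (fun s => angleField γ E s (θ s)) atTop (𝓝 (2 * cos b - γ * 0 - 2 * E)) :=
    (((continuous_cos.tendsto b).comp hb).const_mul 2 |>.sub (hexp.const_mul γ)).sub_const _
  have hmvt : ∀ s : ℝ, ∃ c ∈ Ioo s (s + 1), angleField γ E c (θ c) = θ (s + 1) - θ s := fun s => by
    obtain ⟨c, hc, h⟩ := exists_hasDerivAt_eq_slope θ (fun c => angleField γ E c (θ c))
      (show s < s + 1 by linarith) hθ.continuous.continuousOn (fun x _ => hθ x)
    exact ⟨c, hc, by simpa using h⟩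
  choose c hc hceq using hmvt
  have hctop : Tendsto c atTop atTop := tendsto_atTop_mono (fun s => (hc s).1.le) tendsto_id
  have h1 : Tendsto (fun s => θ (s + 1) - θ s) atTop (𝓝 (b - b)) :=
    (hb.comp (tendsto_atTop_add_const_right _ 1 tendsto_id)).sub hb
  have h2 := hF.comp hctop
  have := tendsto_nhds_unique (h2.congr fun s => hceq s) h1
  linarith

theorem cos_eq_of_tendsto_atBot (hθ : IsSolution γ E θ) {b : ℝ} (hb : Tendsto θ atBot (𝓝 b)) :
    cos b = E := by
  have h := (hθ.reflect 0).cos_eq_of_tendsto_atTop (b := -b)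
    (by simpa using (hb.comp tendsto_neg_atTop_atBot).neg)
  simpa using h

/-- Where the cosine is decreasing, distinct solutions separate in backward time. -/
theorem not_tendsto_of_lt (hθ : IsSolution γ E θ) (hφ : IsSolution γ E φ)
    (hlt : ∀ s, θ s < φ s) (h₁ : ∀ᶠ s in atBot, 0 ≤ θ s) (h₂ : ∀ᶠ s in atBot, φ s ≤ π)
    {a : ℝ} (ha : Tendsto θ atBot (𝓝 a)) : ¬ Tendsto φ atBot (𝓝 a) := by
  intro ha'
  obtain ⟨S, hS⟩ := eventually_atBot.1 (h₁.and h₂)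
  have hanti : AntitoneOn (fun s => φ s - θ s) (Iic S) := by
    refine antitoneOn_of_hasDerivWithinAt_nonpos (convex_Iic S)
      (hφ.continuous.sub hθ.continuous).continuousOn
      (fun s _ => ((hφ s).sub (hθ s)).hasDerivWithinAt) (fun s hs => ?_)
    have h := hS s (interior_subset hs : s ∈ Iic S)
    have := cos_le_cos_of_nonneg_of_le_pi h.1 h.2 (hlt s).le
    unfold angleField
    linarith
  have hge : φ S - θ S ≤ a - a :=
    ge_of_tendsto (ha'.sub ha) (eventually_atBot.2 ⟨S, fun s hs => hanti hs self_mem_Iic hs⟩)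
  linarith [hlt S]

end IsSolution

/-! ### Continuity of the flow in energy and initial value -/

/-- The solution with value `x` at `s = 0`. -/
noncomputable def flow (γ E x : ℝ) : ℝ → ℝ := (exists_isSolution γ E 0 x).choose

theorem isSolution_flow (γ E x : ℝ) : IsSolution γ E (flow γ E x) :=
  (exists_isSolution γ E 0 x).choose_spec.1

@[simp] theorem flow_zero (γ E x : ℝ) : flow γ E x 0 = x :=
  (exists_isSolution γ E 0 x).choose_spec.2

theorem IsSolution.eq_flow {γ E : ℝ} {θ : ℝ → ℝ} (h : IsSolution γ E θ) :
    θ = flow γ E (θ 0) :=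
  h.eq_of_eq (isSolution_flow _ _ _) (flow_zero _ _ _).symm

theorem continuous_flow (γ s : ℝ) : Continuous fun p : ℝ × ℝ => flow γ p.1 p.2 s := by
  refine continuous_iff_continuousAt.2 fun p => ?_
  refine tendsto_iff_dist_tendsto_zero.2 (squeeze_zero (fun _ => dist_nonneg)
    (g := fun q : ℝ × ℝ => gronwallBound |q.2 - p.2| 2 (2 * |q.1 - p.1|) |s|) (fun q => ?_) ?_)
  · rw [Real.dist_eq]
    simpa using (isSolution_flow γ q.1 q.2).abs_sub_le (isSolution_flow γ p.1 p.2) s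
  · have hc : Continuous fun q : ℝ × ℝ => gronwallBound |q.2 - p.2| 2 (2 * |q.1 - p.1|) |s| := by
      simp only [gronwallBound_of_K_ne_0 (two_ne_zero' ℝ)]
      fun_prop
    simpa [gronwallBound_ε0_δ0] using hc.tendsto p

/-! ### The barrier and convergence to the left saddle -/

/-- Far to the left, `1 / (2 s)` is a strict subsolution at every energy `E ≤ 1`. -/
theorem exists_barrier (γ : ℝ) : ∃ S < 0, ∀ s ≤ S, ∀ E ≤ 1,
    -(1 / (2 * s ^ 2)) < angleField γ E s (1 / (2 * s)) := by
  have h := ((tendsto_pow_mul_exp_neg_atTop_nhds_zero 2).const_mul γ).comp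
    tendsto_neg_atBot_atTop
  rw [mul_zero] at h
  obtain ⟨S, hS⟩ := eventually_atBot.1 ((h.eventually_lt_const (show (0 : ℝ) < 1 / 4 by norm_num)))
  refine ⟨min S (-1), by simp, fun s hs E hE => ?_⟩
  have hs0 : s < 0 := by linarith [min_le_right S (-1)]
  have h1 := hS s (hs.trans (min_le_left _ _))
  simp only [Function.comp_apply, neg_sq, neg_neg] at h1
  -- The quadratic bound on cosine makes `2 cos - 2 E` at least `-1/(4 s²)`, while the barrier has
  -- slope `-1/(2 s²)`; the gap `1/(4 s²)` absorbs the exponential term.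
  have h2 := one_sub_sq_div_two_le_cos (x := 1 / (2 * s))
  have hsq : 0 < s ^ 2 := by nlinarith
  rw [angleField, abs_of_neg hs0, neg_neg]
  have h3 : γ * exp s < 1 / (4 * s ^ 2) := by
    rw [lt_div_iff₀ (by positivity)]; linarith
  have h4 : (1 / (2 * s)) ^ 2 = 1 / (4 * s ^ 2) := by
    field_simp; norm_num
  have h5 : 1 / (2 * s ^ 2) = 2 * (1 / (4 * s ^ 2)) := by
    field_simp; norm_num
  rw [h4] at h2
  rw [h5]
  linarith

/-- A time before which `1 / (2 s)` is a strict subsolution. -/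
noncomputable def barrierTime (γ : ℝ) : ℝ := (exists_barrier γ).choose

theorem barrierTime_neg (γ : ℝ) : barrierTime γ < 0 := (exists_barrier γ).choose_spec.1

theorem barrier_nonpos {γ s : ℝ} (hs : s ≤ barrierTime γ) : 1 / (2 * s) ≤ 0 :=
  one_div_nonpos.2 (by linarith [barrierTime_neg γ])

variable {γ E : ℝ} {θ : ℝ → ℝ}

theorem IsSolution.le_barrier (hE : E ≤ 1) (hθ : IsSolution γ E θ) {s₁ s : ℝ}
    (hs₁ : s₁ ≤ barrierTime γ) (h₁ : θ s₁ ≤ 1 / (2 * s₁)) (hs : s ≤ s₁) : θ s ≤ 1 / (2 * s) := by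
  refine hθ.le_of_subsolution (B := fun s => 1 / (2 * s)) (B' := fun s => -(1 / (2 * s ^ 2)))
    (S := barrierTime γ) (fun r hr => ?_)
    (fun r hr => (exists_barrier γ).choose_spec.2 r hr E hE) hs₁ h₁ hs
  have hr0 : r ≠ 0 := by linarith [barrierTime_neg γ, hr] |> ne_of_lt
  have := ((hasDerivAt_inv hr0).const_mul (1 / 2))
  convert! this using 1
  · ext x; simp [mul_comm]
  · field_simp

theorem IsSolution.le_arccos_of_le_barrier (hγ : 0 < γ) (hE : -1 ≤ E) (hE' : E ≤ 1)
    (hθ : IsSolution γ E θ) {s₁ : ℝ} (hs₁ : s₁ ≤ barrierTime γ) (h₁ : θ s₁ ≤ 1 / (2 * s₁))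
    (s : ℝ) : θ s ≤ arccos E := by
  rcases le_total s s₁ with hs | hs
  · exact (hθ.le_barrier hE' hs₁ h₁ hs).trans
      ((barrier_nonpos (hs.trans hs₁)).trans (arccos_nonneg E))
  · exact hθ.le_arccos_of_le hγ hE hE'
      (h₁.trans ((barrier_nonpos hs₁).trans (arccos_nonneg E))) hs

theorem tendsto_barrier : Tendsto (fun s : ℝ => 1 / (2 * s)) atBot (𝓝 0) := by
  simpa using (tendsto_inv_atBot_zero (𝕜 := ℝ)).mul_const (2⁻¹ : ℝ)

/-- For `E = 1` the two bounds squeeze. For `E < 1` a monotonicity argument gives a limit in `[0,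
arccos E]` whose cosine is `E`. -/
theorem IsSolution.tendsto_arccos (hγ : 0 < γ) (hE : -1 ≤ E) (hE' : E ≤ 1)
    (hθ : IsSolution γ E θ) (hle : ∀ s, θ s ≤ arccos E)
    (hge : ∀ s ≤ barrierTime γ, 1 / (2 * s) ≤ θ s) : Tendsto θ atBot (𝓝 (arccos E)) := by
  have hge' : ∀ᶠ s in atBot, 1 / (2 * s) ≤ θ s := eventually_atBot.2 ⟨_, hge⟩
  rcases hE'.eq_or_lt with rfl | hE1
  · rw [arccos_one] at hle ⊢
    exact tendsto_of_tendsto_of_tendsto_of_le_of_le' tendsto_barrier tendsto_const_nhds hge'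
      (Eventually.of_forall hle)
  have hpos : 0 < arccos E := arccos_pos.2 hE1
  obtain ⟨S, hS⟩ := eventually_atBot.1
    ((hge'.and (tendsto_barrier.eventually_const_le (neg_lt_zero.2 hpos))).and
      (eventually_le_atBot 0))
  -- Adding `γ exp s` cancels the exponential term for `s ≤ 0`, leaving the derivative `2 cos θ - 2
  -- E`, nonnegative since `|θ| ≤ arccos E`.
  have hmono : MonotoneOn (fun s => θ s + γ * exp s) (Iic S) := by
    refine monotoneOn_of_hasDerivWithinAt_nonneg (convex_Iic S)
      (hθ.continuous.add (continuous_const.mul continuous_exp)).continuousOn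
      (fun s _ => ((hθ s).add ((Real.hasDerivAt_exp s).const_mul γ)).hasDerivWithinAt)
      (fun s hs => ?_)
    obtain ⟨⟨h1, h2⟩, h3⟩ := hS s (interior_subset hs : s ∈ Iic S)
    have hcos : E ≤ cos (θ s) := by
      rw [← cos_arccos hE hE', ← cos_abs (θ s)]
      exact cos_le_cos_of_nonneg_of_le_pi (abs_nonneg _) (arccos_le_pi E)
        (abs_le.2 ⟨h2.trans h1, hle s⟩)
    rw [angleField, abs_of_nonpos h3, neg_neg]
    linarith
  have hmono' : Monotone fun s => θ (min s S) + γ * exp (min s S) := fun s t hst =>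
    hmono (mem_Iic.2 (min_le_right s S)) (mem_Iic.2 (min_le_right t S)) (min_le_min_right S hst)
  have hbdd : BddBelow (range fun s => θ (min s S) + γ * exp (min s S)) := by
    refine ⟨-arccos E, ?_⟩
    rintro _ ⟨s, rfl⟩
    obtain ⟨⟨h1, h2⟩, -⟩ := hS (min s S) (min_le_right _ _)
    have : 0 < γ * exp (min s S) := by positivity
    simp only
    linarith
  have hlim := tendsto_atBot_ciInf hmono' hbdd
  set L := ⨅ s, θ (min s S) + γ * exp (min s S)
  have hexp : Tendsto (fun s => γ * exp s) atBot (𝓝 0) := by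
    simpa using tendsto_exp_atBot.const_mul γ
  have hL : Tendsto θ atBot (𝓝 L) := by
    have : Tendsto (fun s => θ s + γ * exp s) atBot (𝓝 L) := by
      refine hlim.congr' ?_
      filter_upwards [eventually_le_atBot S] with s hs
      rw [min_eq_left hs]
    simpa using this.sub hexp
  have hL0 : 0 ≤ L := le_of_tendsto_of_tendsto tendsto_barrier hL hge'
  have hL1 : L ≤ arccos E := le_of_tendsto' hL hle
  have hcos := hθ.cos_eq_of_tendsto_atBot hL
  rwa [← hcos, arccos_cos hL0 (hL1.trans (arccos_le_pi E))]

/-! ### The uppermost solution from the left saddle and its dependence on energy -/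

/-- The values at `s = 0` of the solutions that stay below `arccos E`. -/
def lowerSet (γ E : ℝ) : Set ℝ := {x | ∀ s, flow γ E x s ≤ arccos E}

theorem mem_lowerSet_of_le {x y : ℝ} (hxy : x ≤ y) (hy : y ∈ lowerSet γ E) : x ∈ lowerSet γ E :=
  fun s => ((isSolution_flow γ E x).le_of_le (isSolution_flow γ E y) (t := 0)
    (by simpa using hxy) s).trans (hy s)

theorem bddAbove_lowerSet : BddAbove (lowerSet γ E) :=
  ⟨arccos E, fun x hx => by simpa using hx 0⟩

theorem isClosed_setOf_mem_lowerSet (γ : ℝ) : IsClosed {p : ℝ × ℝ | p.2 ∈ lowerSet γ p.1} := by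
  have : {p : ℝ × ℝ | p.2 ∈ lowerSet γ p.1} = ⋂ s, {p | flow γ p.1 p.2 s ≤ arccos p.1} := by
    ext p; simp [lowerSet]
  rw [this]
  exact isClosed_iInter fun s =>
    isClosed_le (continuous_flow γ s) (continuous_arccos.comp continuous_fst)

theorem IsSolution.mem_lowerSet (hγ : 0 < γ) (hE : -1 ≤ E) (hE' : E ≤ 1)
    (hθ : IsSolution γ E θ) {s₁ : ℝ} (hs₁ : s₁ ≤ barrierTime γ) (h₁ : θ s₁ ≤ 1 / (2 * s₁)) :
    θ 0 ∈ lowerSet γ E := fun s => by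
  rw [← hθ.eq_flow]; exact hθ.le_arccos_of_le_barrier hγ hE hE' hs₁ h₁ s

theorem lowerSet_nonempty (hγ : 0 < γ) (hE : -1 ≤ E) (hE' : E ≤ 1) : (lowerSet γ E).Nonempty := by
  obtain ⟨θ, hθ, h⟩ := exists_isSolution γ E (barrierTime γ) (1 / (2 * barrierTime γ))
  exact ⟨θ 0, hθ.mem_lowerSet hγ hE hE' le_rfl h.le⟩

/-- The value at `s = 0` of the uppermost solution emanating from the left saddle. -/
noncomputable def unstableValue (γ E : ℝ) : ℝ := sSup (lowerSet γ E)

/-- The uppermost solution emanating from the left saddle. -/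
noncomputable def unstable (γ E : ℝ) : ℝ → ℝ := flow γ E (unstableValue γ E)

theorem isSolution_unstable (γ E : ℝ) : IsSolution γ E (unstable γ E) := isSolution_flow _ _ _

@[simp] theorem unstable_zero (γ E : ℝ) : unstable γ E 0 = unstableValue γ E := flow_zero _ _ _

theorem unstableValue_mem (hγ : 0 < γ) (hE : -1 ≤ E) (hE' : E ≤ 1) :
    unstableValue γ E ∈ lowerSet γ E := by
  have hcl : IsClosed (lowerSet γ E) :=
    (isClosed_setOf_mem_lowerSet γ).preimage (by fun_prop : Continuous fun x : ℝ => (E, x))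
  exact hcl.csSup_mem (lowerSet_nonempty hγ hE hE') bddAbove_lowerSet

theorem mem_lowerSet_iff (hγ : 0 < γ) (hE : -1 ≤ E) (hE' : E ≤ 1) {x : ℝ} :
    x ∈ lowerSet γ E ↔ x ≤ unstableValue γ E :=
  ⟨fun h => le_csSup bddAbove_lowerSet h,
    fun h => mem_lowerSet_of_le h (unstableValue_mem hγ hE hE')⟩

theorem barrier_le_unstable (hγ : 0 < γ) (hE : -1 ≤ E) (hE' : E ≤ 1) {s : ℝ}
    (hs : s ≤ barrierTime γ) : 1 / (2 * s) ≤ unstable γ E s := by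
  by_contra! h
  obtain ⟨θ, hθ, hθs⟩ := exists_isSolution γ E s (1 / (2 * s))
  have h1 := (mem_lowerSet_iff hγ hE hE').1 (hθ.mem_lowerSet hγ hE hE' hs hθs.le)
  have h2 := (isSolution_unstable γ E).lt_of_lt hθ (by rwa [hθs]) 0
  rw [unstable_zero] at h2
  linarith

theorem tendsto_unstable (hγ : 0 < γ) (hE : -1 ≤ E) (hE' : E ≤ 1) :
    Tendsto (unstable γ E) atBot (𝓝 (arccos E)) :=
  (isSolution_unstable γ E).tendsto_arccos hγ hE hE' (unstableValue_mem hγ hE hE')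
    fun _ hs => barrier_le_unstable hγ hE hE' hs

/-- Below the unstable solution, membership in `lowerSet` is stable under changes of the energy. -/
theorem eventually_mem_lowerSet (hγ : 0 < γ) (hE : -1 ≤ E) (hE' : E < 1) {x : ℝ}
    (hx : x < unstableValue γ E) : ∀ᶠ E' in 𝓝[>] E, x ∈ lowerSet γ E' := by
  have hsol := isSolution_flow γ E x
  have hmem := (mem_lowerSet_iff hγ hE hE'.le).2 hx.le
  -- Otherwise this solution would also tend to `arccos E`, against backward separation. Lying
  -- strictly under the barrier at one fixed time is an open condition in the energy.
  obtain ⟨s, hs, hlt⟩ : ∃ s ≤ barrierTime γ, flow γ E x s < 1 / (2 * s) := by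
    by_contra! h
    have hlim := hsol.tendsto_arccos hγ hE hE'.le hmem h
    refine hsol.not_tendsto_of_lt (isSolution_unstable γ E)
      (hsol.lt_of_lt (isSolution_unstable γ E) (t := 0) (by simpa using hx))
      ((hlim.eventually_const_lt (arccos_pos.2 hE')).mono fun _ => le_of_lt)
      (Eventually.of_forall fun s => (unstableValue_mem hγ hE hE'.le s).trans (arccos_le_pi E))
      hlim (tendsto_unstable hγ hE hE'.le)
  have hcont : Continuous fun E' => flow γ E' x s :=
    (continuous_flow γ s).comp (by fun_prop : Continuous fun E' : ℝ => (E', x))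
  filter_upwards [nhdsWithin_le_nhds ((hcont.tendsto E).eventually_lt_const hlt),
    nhdsWithin_le_nhds (eventually_lt_nhds hE'), self_mem_nhdsWithin] with E' h1 h2 h3
  have := (isSolution_flow γ E' x).mem_lowerSet hγ (hE.trans (le_of_lt h3)) h2.le hs h1.le
  rwa [flow_zero] at this

/-- If the unstable value passes the level `c` between two energies, it attains it. -/
theorem exists_unstableValue_eq (hγ : 0 < γ) {E₁ E₂ c : ℝ} (h₁ : -1 ≤ E₁) (h₁₂ : E₁ < E₂)
    (h₂ : E₂ ≤ 1) (hc₁ : c < unstableValue γ E₁) (hc₂ : unstableValue γ E₂ < c) :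
    ∃ E ∈ Ioo E₁ E₂, unstableValue γ E = c := by
  set T := {E | c ∈ lowerSet γ E} ∩ Icc E₁ E₂
  have hT : IsClosed T := IsClosed.inter
    ((isClosed_setOf_mem_lowerSet γ).preimage (by fun_prop : Continuous fun E : ℝ => (E, c)))
    isClosed_Icc
  have hbdd : BddAbove T := ⟨E₂, fun E hE => hE.2.2⟩
  have hmem : sSup T ∈ T := hT.csSup_mem
    ⟨E₁, (mem_lowerSet_iff hγ h₁ (h₁₂.le.trans h₂)).2 hc₁.le, le_rfl, h₁₂.le⟩ hbdd
  set E := sSup T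
  have hE : -1 ≤ E := h₁.trans hmem.2.1
  have hle : c ≤ unstableValue γ E :=
    (mem_lowerSet_iff hγ hE (hmem.2.2.trans h₂)).1 hmem.1
  have hlt₂ : E < E₂ := hmem.2.2.lt_of_ne fun h => by rw [h] at hle; linarith
  have heq : unstableValue γ E = c := by
    refine (hle.eq_or_lt.resolve_right fun hlt => ?_).symm
    -- A strict inequality would put energies beyond the supremum into `T`.
    obtain ⟨E', h1, h2, h3⟩ := ((eventually_mem_lowerSet hγ hE (hlt₂.trans_le h₂) hlt).and
      (Ioo_mem_nhdsGT hlt₂)).exists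
    exact absurd (le_csSup hbdd ⟨h1, hmem.2.1.trans h2.le, h3.le⟩) (not_le.2 h2)
  refine ⟨E, ⟨hmem.2.1.lt_of_ne fun h => ?_, hlt₂⟩, heq⟩
  rw [← h] at heq
  linarith

/-! ### Trajectories, limit sets and winding numbers -/

/-- The trajectory on the strip that belongs to a solution of the `Θ`-equation. -/
noncomputable def lift (θ : ℝ → ℝ) (τ : ℝ) : ℝ × ℝ := (arctan τ, θ τ)

theorem IsSolution.isTrajectory_lift (hθ : IsSolution γ E θ) : IsTrajectory γ E (lift θ) := by
  refine fun τ => ⟨arctan_mem_Ioo τ, ?_⟩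
  have h := (hasDerivAt_arctan τ).prodMk (hθ τ)
  convert! h using 1
  simp [field, lift, angleField, cos_sq_arctan]

theorem alphaLimitSet_eq_of_tendsto {y : ℝ → ℝ × ℝ} {p : ℝ × ℝ} (h : Tendsto y atBot (𝓝 p)) :
    alphaLimitSet y = {p} := by
  ext q
  constructor
  · rintro ⟨t, ht, hq⟩
    exact tendsto_nhds_unique hq (h.comp ht)
  · rintro rfl
    have ht : Tendsto (fun n : ℕ => -(n : ℝ)) atTop atBot :=
      tendsto_neg_atTop_atBot.comp tendsto_natCast_atTop_atTop
    exact ⟨_, ht, h.comp ht⟩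

theorem omegaLimitSet_eq_of_tendsto {y : ℝ → ℝ × ℝ} {p : ℝ × ℝ} (h : Tendsto y atTop (𝓝 p)) :
    omegaLimitSet y = {p} := by
  ext q
  constructor
  · rintro ⟨t, ht, hq⟩
    exact tendsto_nhds_unique hq (h.comp ht)
  · rintro rfl
    exact ⟨_, tendsto_natCast_atTop_atTop, h.comp tendsto_natCast_atTop_atTop⟩

theorem IsSolution.leavesSaddle_lift (hθ : IsSolution γ E θ)
    (h : Tendsto θ atBot (𝓝 (arccos E))) : LeavesSaddle γ E (lift θ) :=
  ⟨hθ.isTrajectory_lift, alphaLimitSet_eq_of_tendsto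
    ((tendsto_arctan_atBot.mono_right nhdsWithin_le_nhds).prodMk_nhds h)⟩

theorem leavesSaddle_unstable (hγ : 0 < γ) (hE : -1 ≤ E) (hE' : E ≤ 1) :
    LeavesSaddle γ E (lift (unstable γ E)) :=
  (isSolution_unstable γ E).leavesSaddle_lift (tendsto_unstable hγ hE hE')

/-- The mirror image of the unstable solution, which tends to `-arccos E - 2 π N`. -/
noncomputable def stable (γ E : ℝ) (N : ℤ) (s : ℝ) : ℝ := -unstable γ E (-s) - 2 * π * N

theorem isSolution_stable (γ E : ℝ) (N : ℤ) : IsSolution γ E (stable γ E N) :=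
  (isSolution_unstable γ E).reflect N

theorem stable_zero (γ E : ℝ) (N : ℤ) : stable γ E N 0 = -unstableValue γ E - 2 * π * N := by
  simp [stable]

theorem tendsto_stable (hγ : 0 < γ) (hE : -1 ≤ E) (hE' : E ≤ 1) (N : ℤ) :
    Tendsto (stable γ E N) atTop (𝓝 (-arccos E - 2 * π * N)) :=
  (((tendsto_unstable hγ hE hE').comp tendsto_neg_atTop_atBot).neg).sub_const _

theorem floor_winding (hE : -1 < E) (N : ℤ) :
    ⌊(arccos E - (-arccos E - 2 * π * N)) / (2 * π)⌋ = N := by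
  have h := arccos_nonneg E
  have h' : arccos E < π := (arccos_le_pi E).lt_of_ne fun h => by
    rw [arccos_eq_pi] at h; linarith
  rw [Int.floor_eq_iff, le_div_iff₀ two_pi_pos, div_lt_iff₀ two_pi_pos]
  constructor <;> linarith

/-- When the unstable solution is its own mirror image, it is a saddles connector. -/
theorem isSaddlesConnector_unstable (hγ : 0 < γ) (hE : -1 < E) (hE' : E < 1) {N : ℤ}
    (h : unstableValue γ E = -(π * N)) :
    IsSaddlesConnector γ E (lift (unstable γ E)) ∧ HasWindingNumber (lift (unstable γ E)) N := by
  have heq : unstable γ E = stable γ E N :=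
    (isSolution_unstable γ E).eq_of_eq (isSolution_stable γ E N) (t := 0) (by
      rw [unstable_zero, stable_zero, h]; ring)
  have hlim : Tendsto (unstable γ E) atTop (𝓝 (-arccos E - 2 * π * N)) := by
    rw [heq]; exact tendsto_stable hγ hE.le hE'.le N
  refine ⟨⟨hE, hE', leavesSaddle_unstable hγ hE.le hE'.le, N, omegaLimitSet_eq_of_tendsto
    ((tendsto_arctan_atTop.mono_right nhdsWithin_le_nhds).prodMk_nhds hlim)⟩,
    arccos E, _, tendsto_unstable hγ hE.le hE'.le, hlim, (floor_winding hE N).symm⟩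

theorem HasWindingNumber.exists_tendsto {w : ℤ} {a : ℝ} (h : HasWindingNumber (lift θ) w)
    (ha : Tendsto θ atBot (𝓝 a)) :
    ∃ b, Tendsto θ atTop (𝓝 b) ∧ w = ⌊(a - b) / (2 * π)⌋ := by
  obtain ⟨a', b, ha', hb, hw⟩ := h
  have : a' = a := tendsto_nhds_unique ha' ha
  subst this
  exact ⟨b, hb, hw⟩

theorem unstableValue_lt_of_winding (hγ : 0 < γ) (hE : -1 < E) (hE' : E ≤ 1) {N w : ℤ}
    (hw : HasWindingNumber (lift (unstable γ E)) w) (hN : N + 1 ≤ w) :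
    unstableValue γ E < -(π * N) := by
  by_contra! h
  obtain ⟨b, hb, rfl⟩ := hw.exists_tendsto (tendsto_unstable hγ hE.le hE')
  have hle := (isSolution_stable γ E N).le_of_le (isSolution_unstable γ E) (t := 0)
    (by rw [stable_zero, unstable_zero]; linarith)
  have hb' := le_of_tendsto_of_tendsto' (tendsto_stable hγ hE.le hE' N) hb hle
  have : ⌊(arccos E - b) / (2 * π)⌋ ≤ N := by
    rw [← floor_winding hE N]
    gcongr
  omega

/-- If the limit held, reflection would give a second, strictly larger solution tending to `arccos
E` at `-∞`, against backward separation. -/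
theorem stable_not_tendsto_of_lt (hγ : 0 < γ) (hE : -1 < E) (hE' : E < 1) {N : ℤ}
    (h : unstableValue γ E < -(π * N)) :
    ¬ Tendsto (unstable γ E) atTop (𝓝 (-arccos E - 2 * π * N)) := by
  intro hlim
  have hlim' : Tendsto (stable γ E N) atBot (𝓝 (arccos E)) := by
    change Tendsto (fun s => -unstable γ E (-s) - 2 * π * N) atBot _
    simpa using ((hlim.comp tendsto_neg_atBot_atTop).neg).sub_const (2 * π * N)
  have hpi : arccos E < π := (arccos_le_pi E).lt_of_ne fun h => by
    rw [arccos_eq_pi] at h; linarith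
  have hu := tendsto_unstable hγ hE.le hE'.le
  refine (isSolution_unstable γ E).not_tendsto_of_lt (isSolution_stable γ E N)
    ((isSolution_unstable γ E).lt_of_lt (isSolution_stable γ E N) (t := 0)
      (by rw [stable_zero, unstable_zero]; linarith))
    ((hu.eventually_const_lt (arccos_pos.2 hE')).mono fun _ => le_of_lt)
    ((hlim'.eventually_lt_const hpi).mono fun _ => le_of_lt) hu hlim'

/-- Were the value smaller, the limit `b` would lie strictly below `-arccos E - 2πN`. The next lower
zero of `cos b = E` already forces winding at least `N + 1`. At `E = -1` the two zeros merge, so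
even equality is excluded. -/
theorem le_unstableValue_of_winding (hγ : 0 < γ) (hE : -1 ≤ E) (hE' : E < 1) {N w : ℤ}
    (hw : HasWindingNumber (lift (unstable γ E)) w) (hN : w ≤ N) :
    -(π * N) ≤ unstableValue γ E ∧ (E = -1 → -(π * N) < unstableValue γ E) := by
  obtain ⟨b, hb, rfl⟩ := hw.exists_tendsto (tendsto_unstable hγ hE hE'.le)
  have hfl : (arccos E - b) / (2 * π) < N + 1 := by
    have := Int.floor_lt.1 (Int.lt_add_one_of_le hN)
    simpa using this
  rw [div_lt_iff₀ two_pi_pos] at hfl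
  have key : unstableValue γ E ≤ -(π * N) → b ≤ -arccos E - 2 * π * N := fun h =>
    le_of_tendsto_of_tendsto' hb (tendsto_stable hγ hE hE'.le N)
      ((isSolution_unstable γ E).le_of_le (isSolution_stable γ E N) (t := 0)
        (by rw [stable_zero, unstable_zero]; linarith))
  have hbot : E = -1 → -(π * N) < unstableValue γ E := by
    rintro rfl
    by_contra! h
    have := key h
    rw [arccos_neg_one] at this hfl
    linarith
  refine ⟨?_, hbot⟩
  rcases hE.eq_or_lt with h | hE1
  · exact (hbot h.symm).le
  by_contra! h
  have hne := stable_not_tendsto_of_lt hγ hE1 hE' h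
  have hlt : b < -arccos E - 2 * π * N := (key h.le).lt_of_ne fun hb' => hne (hb' ▸ hb)
  have hcos : cos (-(b + N * (2 * π))) = E := by
    rw [cos_neg, cos_add_int_mul_two_pi]
    exact (isSolution_unstable γ E).cos_eq_of_tendsto_atTop hb
  -- No `x` strictly between `arccos E` and `2π - arccos E` has cosine `E`; the upper bound on `x`
  -- is the winding hypothesis.
  set x := -(b + N * (2 * π))
  have h1 : arccos E < x := by simp only [x]; linarith
  have h2 : x < 2 * π - arccos E := by simp only [x]; linarith
  have h0 : 0 ≤ x := (arccos_nonneg E).trans h1.le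
  rcases le_total x π with hx | hx
  · rw [← hcos, arccos_cos h0 hx] at h1
    exact lt_irrefl _ h1
  · have : arccos E = 2 * π - x := by
      rw [← hcos, ← cos_two_pi_sub, arccos_cos (by linarith [arccos_nonneg E]) (by linarith)]
    linarith

end DiracCylinder

theorem theorem1 (γ : ℝ) (hγ : 0 < γ) (N : ℤ) (E₁ E₂ : ℝ)
    (h₁ : -1 ≤ E₁) (h₁₂ : E₁ < E₂) (h₂ : E₂ ≤ 1)
    (hw₁ : ∀ y : ℝ → ℝ × ℝ, DiracCylinder.LeavesSaddle γ E₁ y →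
      ∃ w : ℤ, DiracCylinder.HasWindingNumber y w ∧ w ≤ N)
    (hw₂ : ∀ y : ℝ → ℝ × ℝ, DiracCylinder.LeavesSaddle γ E₂ y →
      ∃ w : ℤ, DiracCylinder.HasWindingNumber y w ∧ N + 1 ≤ w) :
    (∃ E ∈ Set.Ioo E₁ E₂, ∃ y : ℝ → ℝ × ℝ,
      DiracCylinder.IsSaddlesConnector γ E y ∧ DiracCylinder.HasWindingNumber y N) ∨
    (∃ y : ℝ → ℝ × ℝ,
      DiracCylinder.IsSaddlesConnector γ E₁ y ∧ DiracCylinder.HasWindingNumber y N) := by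
  have hE₁ : E₁ < 1 := h₁₂.trans_le h₂
  have hE₂ : -1 < E₂ := h₁.trans_lt h₁₂
  obtain ⟨w₁, hw₁, hN₁⟩ := hw₁ _ (DiracCylinder.leavesSaddle_unstable hγ h₁ hE₁.le)
  obtain ⟨w₂, hw₂, hN₂⟩ := hw₂ _ (DiracCylinder.leavesSaddle_unstable hγ hE₂.le h₂)
  have hlt₂ := DiracCylinder.unstableValue_lt_of_winding hγ hE₂ h₂ hw₂ hN₂
  obtain ⟨hle₁, hbot⟩ := DiracCylinder.le_unstableValue_of_winding hγ h₁ hE₁ hw₁ hN₁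
  rcases hle₁.eq_or_lt with heq | hlt₁
  · have h₁' : -1 < E₁ := h₁.lt_of_ne fun h => (hbot h.symm).ne heq
    exact Or.inr ⟨_, DiracCylinder.isSaddlesConnector_unstable hγ h₁' hE₁ heq.symm⟩
  · obtain ⟨E, hE, heq⟩ := DiracCylinder.exists_unstableValue_eq hγ h₁ h₁₂ h₂ hlt₁ hlt₂
    exact Or.inl ⟨E, hE, _, DiracCylinder.isSaddlesConnector_unstable hγ (h₁.trans_lt hE.1)
      (hE.2.trans_le h₂) heq⟩
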